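/- Let $(X,d)$ be a complete, separable, non-compact metric space and let $m$ be a locally finite Borel measure on $X$ with full support. Assume that $(X,d,m)$ satisfies $\mathrm{CD}(0,\infty)$: any two Borel probability measures $\mu_0,\mu_1$ with finite second moment are joined by a geodesic $(\mu_t)_{t\in[0,1]}$ of the $L^2$-Wasserstein space such that $\mathrm{Ent}_m(\mu_t)\le t\,\mathrm{Ent}_m(\mu_1)+(1-t)\,\mathrm{Ent}_m(\mu_0)$ for all $t\in[0,1]$, where $\mathrm{Ent}_m(\mu)=\int\rho\ln\rho\,dm$ if $\mu=\rho\,m$ and $\mathrm{Ent}_m(\mu)=+\infty$ otherwise. For a Borel set $\Omega$ with $m(\Omega)<\infty$ put $$m^+(\Omega)=\liminf_{\varepsilon\to0^+}\frac{m(\Omega^\varepsilon)-m(\Omega)}{\varepsilon},\qquad \Omega^\varepsilon=\{x: d(x,\Omega)<\varepsilon\}.$$ Then the volume entropy $$h=\lim_{r\to\infty}\frac{\ln m(B_r(x_0))}{r}\in[0,\infty]$$ exists for every $x_0\in X$ and does not depend on $x_0$, and: 1. for no constant $C>h$ does the inequality $m^+(\Omega)\ge C\,m(\Omega)$ hold for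 all Borel sets $\Omega\subset X$ with $m(\Omega)<\infty$; 2. if $m(X)=\infty$, then the Cheeger constant $\inf\{m^+(\Omega)/m(\Omega):\Omega\subset X\text{ Borel},\ 0<m(\Omega)<\infty\}$ equals $h$. -/

import Mathlib

open MeasureTheory Filter Topology
open scoped ENNReal

noncomputable section

/-- The Minkowski content `m⁺(Ω) = liminf_{ε → 0⁺} (m(Ω^ε) - m(Ω)) / ε`, where
`Ω^ε = {x : d(x, Ω) < ε}`. It is used for sets `Ω` with `m(Ω) < ∞`; as `Ω ⊆ Ω^ε`, the
truncated subtraction of `ℝ≥0∞` is the honest one there. -/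
def minkowskiContent {X : Type*} [MetricSpace X] [MeasurableSpace X]
    (m : Measure X) (Ω : Set X) : ℝ≥0∞ :=
  liminf (fun ε : ℝ => (m (Metric.thickening ε Ω) - m Ω) / ENNReal.ofReal ε) (𝓝[>] (0 : ℝ))

/-- The Cheeger constant: the infimum of `m⁺(Ω) / m(Ω)` over the Borel sets `Ω` with
`0 < m(Ω) < ∞`. -/
def cheegerConstant {X : Type*} [MetricSpace X] [MeasurableSpace X] (m : Measure X) : ℝ≥0∞ :=
  ⨅ (Ω : Set X) (_ : MeasurableSet Ω) (_ : 0 < m Ω) (_ : m Ω < ∞), minkowskiContent m Ω / m Ω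

/-- `h` is the volume entropy of `m` computed from the base point `x₀`:
`(ln m(B_r(x₀))) / r → h` as `r → ∞`, in the extended reals. -/
def HasVolumeEntropyAt {X : Type*} [MetricSpace X] [MeasurableSpace X]
    (m : Measure X) (x₀ : X) (h : ℝ≥0∞) : Prop :=
  Tendsto (fun r : ℝ => ENNReal.log (m (Metric.ball x₀ r)) / (r : EReal)) atTop
    (𝓝 (h : EReal))

/-- `μ ∈ P₂(X)`: a Borel probability measure with finite second moment. -/
def MemP2 {X : Type*} [MetricSpace X] [MeasurableSpace X] (μ : Measure X) : Prop :=
  IsProbabilityMeasure μ ∧ ∃ x₀ : X, ∫⁻ x, edist x x₀ ^ 2 ∂μ < ∞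

/-- `π` is a coupling (transport plan) of `μ` and `ν`. -/
def IsCoupling {X : Type*} [MeasurableSpace X] (μ ν : Measure X) (π : Measure (X × X)) : Prop :=
  π.map Prod.fst = μ ∧ π.map Prod.snd = ν

/-- The `L²`-Wasserstein distance. -/
def wassersteinTwo {X : Type*} [MetricSpace X] [MeasurableSpace X] (μ ν : Measure X) : ℝ≥0∞ :=
  (⨅ (π : Measure (X × X)) (_ : IsCoupling μ ν π), ∫⁻ p, edist p.1 p.2 ^ 2 ∂π) ^ (1 / 2 : ℝ)

/-- `(γ t)`, `t ∈ [0, 1]`, is a (constant speed, minimizing) geodesic from `μ₀` to `μ₁` in the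
`L²`-Wasserstein space `(P₂(X), W₂)`. -/
def IsWassersteinGeodesic {X : Type*} [MetricSpace X] [MeasurableSpace X]
    (μ₀ μ₁ : Measure X) (γ : ℝ → Measure X) : Prop :=
  γ 0 = μ₀ ∧ γ 1 = μ₁ ∧ (∀ t ∈ Set.Icc (0 : ℝ) 1, MemP2 (γ t)) ∧
    ∀ s ∈ Set.Icc (0 : ℝ) 1, ∀ t ∈ Set.Icc (0 : ℝ) 1,
      wassersteinTwo (γ s) (γ t) = ENNReal.ofReal |t - s| * wassersteinTwo μ₀ μ₁

open scoped Classical in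
/-- The relative entropy `Ent_m(μ) = ∫ ρ ln ρ dm` if `μ = ρ m`, and `+∞` otherwise. The integral
is the positive part minus the negative part in the extended reals, and it is `+∞` when
the positive part has infinite integral. -/
def relEntropy {X : Type*} [MeasurableSpace X] (m μ : Measure X) : EReal :=
  let f : X → ℝ := fun x => (μ.rnDeriv m x).toReal * Real.log (μ.rnDeriv m x).toReal
  if μ ≪ m ∧ ∫⁻ x, ENNReal.ofReal (f x) ∂m < ∞ then
    ((∫⁻ x, ENNReal.ofReal (f x) ∂m : ℝ≥0∞) : EReal)
      - ((∫⁻ x, ENNReal.ofReal (-f x) ∂m : ℝ≥0∞) : EReal)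
  else ⊤

/-- Non-negative Ricci curvature, `CD(0, ∞)`, in the sense of Lott, Sturm and Villani: any two
measures in `P₂(X)` are joined by a `W₂`-geodesic along which the relative entropy is convex.
If one of the two entropies at the ends is `+∞`, the convexity inequality is void for
`0 < t < 1` and an equality or void for `t = 0, 1`; it is therefore only written for ends of
entropy `< +∞`, which avoids the meaningless sum of `+∞` and `-∞`. -/
def IsCDZeroInfty {X : Type*} [MetricSpace X] [MeasurableSpace X] (m : Measure X) : Prop :=
  ∀ μ₀ μ₁ : Measure X, MemP2 μ₀ → MemP2 μ₁ →
    ∃ γ : ℝ → Measure X, IsWassersteinGeodesic μ₀ μ₁ γ ∧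
      (relEntropy m μ₀ < ⊤ → relEntropy m μ₁ < ⊤ → ∀ t ∈ Set.Icc (0 : ℝ) 1,
        relEntropy m (γ t) ≤
          (t : EReal) * relEntropy m μ₁ + ((1 - t : ℝ) : EReal) * relEntropy m μ₀)

end

/-! Convexity of entropy yields a Brunn-Minkowski inequality. Join the uniform measures on `A` and
`B` by a Wasserstein geodesic. If all distances between `A` and `B` are at most `L`, its measure at
time `t` lives on `A^s` for every `s > tL`. A probability measure on `T` has entropy at least `-ln
m(T)`, with equality for the uniform one, so `ln m(A^s) ≥ (1-t) ln m(A) + t ln m(B)`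
(`log_measure_thickening_ge`).

Take `A ⊆ B_D(x₀)`, `B = B_R(x₀)` and `t` close to `ε/(R+D)`. With `A` a unit ball, this says that
the slopes of `r ↦ ln m(B_r)` from `1` almost decrease, so the entropy `h` exists and is finite. For
general bounded `A`, letting `R → ∞` gives `m(A^ε) ≥ e^{hε} m(A)`. Hence `m⁺(Ω) ≥ h m(Ω)`, first
through bounded pieces of `Ω` and then through `ε → 0`.

Conversely, if `m⁺(B_r) ≥ C m(B_r)` held for all balls about `x₀` with some `C > h`, integrating in
`r` would make `m(B_r)` grow at an exponential rate above `h` (`exists_minkowskiContent_ball_lt`).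
-/

/-! ### Entropy of uniform measures and Jensen's inequality -/

section Entropy

variable {X : Type*} [MeasurableSpace X]

lemma relEntropy_cond (m : Measure X) [SigmaFinite m] {A : Set X} (hA : MeasurableSet A)
    (h0 : m A ≠ 0) (hT : m A ≠ ∞) :
    relEntropy m (ProbabilityTheory.cond m A) = ((-Real.log (m A).toReal : ℝ) : EReal) := by
  have hcond : ProbabilityTheory.cond m A
      = m.withDensity (A.indicator fun _ => (m A)⁻¹) := by
    rw [withDensity_indicator hA, withDensity_const, ProbabilityTheory.cond]
  have hac : ProbabilityTheory.cond m A ≪ m := hcond ▸ withDensity_absolutelyContinuous _ _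
  have hrn : (ProbabilityTheory.cond m A).rnDeriv m =ᵐ[m] A.indicator fun _ => (m A)⁻¹ := by
    rw [hcond]
    exact Measure.rnDeriv_withDensity m (measurable_const.indicator hA)
  set M := (m A).toReal with hM
  have hMpos : 0 < M := ENNReal.toReal_pos h0 hT
  -- The values `c = 1` and `c = -1` give the positive and negative parts of the entropy integral.
  have key : ∀ c : ℝ, ∫⁻ x, ENNReal.ofReal (c *
      (((ProbabilityTheory.cond m A).rnDeriv m x).toReal *
        Real.log ((ProbabilityTheory.cond m A).rnDeriv m x).toReal)) ∂m
      = ENNReal.ofReal (c * (-Real.log M)) := by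
    intro c
    have : ∀ᵐ x ∂m, ENNReal.ofReal (c *
      (((ProbabilityTheory.cond m A).rnDeriv m x).toReal *
        Real.log ((ProbabilityTheory.cond m A).rnDeriv m x).toReal))
        = A.indicator (fun _ => ENNReal.ofReal (c * (M⁻¹ * Real.log M⁻¹))) x := by
      filter_upwards [hrn] with x hx
      rw [hx]
      by_cases hxA : x ∈ A
      · simp [hxA, hM]
      · simp [hxA]
    rw [lintegral_congr_ae this, lintegral_indicator hA, lintegral_const,
      Measure.restrict_apply_univ, ← ENNReal.ofReal_toReal hT, ← hM,
      ← ENNReal.ofReal_mul' hMpos.le, Real.log_inv]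
    congr 1
    field_simp
  have k1 := key 1
  have k2 := key (-1)
  simp only [one_mul, neg_one_mul, neg_neg] at k1 k2
  unfold relEntropy
  simp only
  rw [if_pos ⟨hac, by rw [k1]; exact ENNReal.ofReal_lt_top⟩, k1, k2]
  rcases le_total 0 (Real.log M) with h | h
  · rw [ENNReal.ofReal_of_nonpos (by linarith : -Real.log M ≤ 0)]
    simp [h]
  · rw [ENNReal.ofReal_of_nonpos h]
    simp [h]

/-- Jensen's inequality for `u ln u`, in the form of its tangent at `a`: `u ln u ≥ u ln a + u - a`.
The slope point `a = 1 / m(T)` is the density of the uniform measure, where the bound is sharp. -/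
lemma neg_log_measure_le_of_relEntropy_le (m ν : Measure X) [SigmaFinite m]
    [IsProbabilityMeasure ν] {T : Set X} (hT : MeasurableSet T) (hν : ν Tᶜ = 0) (hfin : m T ≠ ∞)
    {c : ℝ} (hc : relEntropy m ν ≤ c) : -Real.log (m T).toReal ≤ c := by
  unfold relEntropy at hc
  simp only at hc
  split_ifs at hc with hcond
  swap
  · exact absurd hc (by simp)
  obtain ⟨hac, hpos⟩ := hcond
  set ρ : X → ℝ := fun x => (ν.rnDeriv m x).toReal with hρ
  have hρm : Measurable ρ := (Measure.measurable_rnDeriv ν m).ennreal_toReal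
  have hρ0 : ∀ x, 0 ≤ ρ x := fun x => ENNReal.toReal_nonneg
  have hρi : Integrable ρ m := Measure.integrable_toReal_rnDeriv
  have hρ1 : ∫ x, ρ x ∂m = 1 := by
    rw [hρ, Measure.integral_toReal_rnDeriv hac]; simp
  have hoff : ∀ᵐ x ∂m, x ∉ T → ρ x = 0 := by
    have h1 : ∫⁻ x in Tᶜ, ν.rnDeriv m x ∂m = 0 := by
      rw [Measure.setLIntegral_rnDeriv hac, hν]
    rw [lintegral_eq_zero_iff (Measure.measurable_rnDeriv ν m), Filter.EventuallyEq,
      ae_restrict_iff' hT.compl] at h1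
    filter_upwards [h1] with x hx hxT
    simp [hρ, hx hxT]
  have hνT : ν T = 1 := by
    have := prob_compl_eq_zero_iff (μ := ν) hT
    exact this.1 hν
  have hmT : m T ≠ 0 := fun h => by simp [hac h] at hνT
  set M := (m T).toReal with hM
  have hMpos : 0 < M := ENNReal.toReal_pos hmT hfin
  set f : X → ℝ := fun x => ρ x * Real.log (ρ x) with hf
  have hfm : Measurable f := hρm.mul hρm.log
  have ineq : ∀ a : ℝ, 0 < a → ∀ᵐ x ∂m,
      ρ x * Real.log a + ρ x - T.indicator (fun _ => a) x ≤ f x := by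
    intro a ha
    filter_upwards [hoff] with x hx
    by_cases hxT : x ∈ T
    · simp only [hxT, Set.indicator_of_mem, hf]
      rcases (hρ0 x).eq_or_lt with h | h
      · rw [← h]; simp [ha.le]
      · have := Real.log_le_sub_one_of_pos (div_pos ha h)
        rw [Real.log_div ha.ne' h.ne'] at this
        have h2 := mul_le_mul_of_nonneg_left this h.le
        have h3 : ρ x * (a / ρ x - 1) = a - ρ x := by field_simp
        rw [h3] at h2
        linarith
    · simp [hf, hx hxT, hxT]
  have hind : ∀ a : ℝ, Integrable (T.indicator (fun _ => a)) m := fun a =>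
    (integrable_indicator_iff hT).2 (integrableOn_const hfin)
  -- The tangent at `a = 1` gives `f ≥ -1` on `T`, so finiteness of `m T` controls the negative
  -- part.
  have hneg : ∫⁻ x, ENNReal.ofReal (-f x) ∂m < ∞ := by
    calc ∫⁻ x, ENNReal.ofReal (-f x) ∂m ≤ ∫⁻ x, T.indicator (fun _ => 1) x ∂m := by
          apply lintegral_mono_ae
          filter_upwards [ineq 1 one_pos] with x hx
          by_cases hxT : x ∈ T
          · simp only [hxT, Set.indicator_of_mem, Real.log_one] at hx ⊢
            rw [ENNReal.ofReal_le_one]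
            linarith [hρ0 x]
          · simp only [hxT, not_false_eq_true, Set.indicator_of_notMem, Real.log_one] at hx ⊢
            rw [ENNReal.ofReal_of_nonpos]
            linarith [hρ0 x]
      _ = m T := by rw [lintegral_indicator hT]; simp
      _ < ∞ := hfin.lt_top
  have hfi : Integrable f m := by
    refine ⟨hfm.aestronglyMeasurable, ?_⟩
    rw [hasFiniteIntegral_iff_norm]
    calc ∫⁻ x, ENNReal.ofReal ‖f x‖ ∂m
        ≤ ∫⁻ x, (ENNReal.ofReal (f x) + ENNReal.ofReal (-f x)) ∂m := by
          apply lintegral_mono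
          intro x
          simp only [Real.norm_eq_abs]
          rcases abs_cases (f x) with ⟨h, -⟩ | ⟨h, -⟩ <;> simp [h]
      _ = _ := lintegral_add_left hfm.ennreal_ofReal _
      _ < ∞ := ENNReal.add_lt_top.2 ⟨hpos, hneg⟩
  have hint := integral_eq_lintegral_pos_part_sub_lintegral_neg_part hfi
  have hle : ∫ x, f x ∂m ≤ c := by
    rw [hint]
    rw [← ENNReal.ofReal_toReal hpos.ne, ← ENNReal.ofReal_toReal hneg.ne] at hc
    simp only [EReal.coe_ennreal_ofReal, ENNReal.toReal_nonneg, max_eq_left] at hc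
    exact_mod_cast hc
  have hge := integral_mono_ae (((hρi.mul_const _).add hρi).sub (hind M⁻¹)) hfi
    (ineq M⁻¹ (inv_pos.2 hMpos))
  have hcomp : ∫ x, ((fun x => ρ x * Real.log M⁻¹) + ρ - T.indicator fun _ => M⁻¹) x ∂m
      = -Real.log M := by
    rw [integral_sub' ((hρi.mul_const _).add hρi) (hind _), integral_add' (hρi.mul_const _) hρi,
      integral_mul_const, hρ1, integral_indicator hT, setIntegral_const, measureReal_def, ← hM,
      Real.log_inv, smul_eq_mul, mul_inv_cancel₀ hMpos.ne']
    ring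
  linarith [hcomp ▸ hge]

end Entropy

/-! ### Where intermediate points of a Wasserstein geodesic live -/

section Transport

/-- Disintegrate both plans over the common marginal `ν` and make the outer points conditionally
independent. The middle point comes first in the triple: `p = (y, x, z)`. -/
lemma exists_gluing {X : Type*} [MeasurableSpace X] [StandardBorelSpace X] [Nonempty X]
    {μ₀ ν μ₁ : Measure X} [IsFiniteMeasure ν] {ρ₁ ρ₂ : Measure (X × X)}
    (h₁ : IsCoupling μ₀ ν ρ₁) (h₂ : IsCoupling ν μ₁ ρ₂) :
    ∃ P : Measure (X × X × X), P.map (fun p => (p.2.1, p.1)) = ρ₁ ∧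
      P.map (fun p => (p.1, p.2.2)) = ρ₂ := by
  have : IsFiniteMeasure ρ₁ := by
    have : IsFiniteMeasure (ρ₁.map Prod.snd) := h₁.2 ▸ inferInstance
    exact Measure.isFiniteMeasure_of_map (f := Prod.snd) (by fun_prop)
  have : IsFiniteMeasure ρ₂ := by
    have : IsFiniteMeasure (ρ₂.map Prod.fst) := h₂.1 ▸ inferInstance
    exact Measure.isFiniteMeasure_of_map (f := Prod.fst) (by fun_prop)
  set σ : Measure (X × X) := ρ₁.map Prod.swap with hσ
  have : IsFiniteMeasure σ := Measure.isFiniteMeasure_map _ _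
  have hσν : σ.fst = ν := by
    rw [hσ, Measure.fst, Measure.map_map measurable_fst measurable_swap, ← h₁.2]
    rfl
  have hρν : ρ₂.fst = ν := h₂.1
  refine ⟨ν.compProd (ProbabilityTheory.Kernel.prod σ.condKernel ρ₂.condKernel), ?_, ?_⟩
  · have hs : (ν.compProd (ProbabilityTheory.Kernel.prod σ.condKernel ρ₂.condKernel)).map
        (Prod.map id Prod.fst) = σ := by
      rw [← Measure.compProd_map measurable_fst]
      rw [← ProbabilityTheory.Kernel.fst_eq, ProbabilityTheory.Kernel.fst_prod]
      nth_rewrite 1 [← hσν]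
      exact σ.disintegrate σ.condKernel
    have hsw : σ.map Prod.swap = ρ₁ := by
      rw [hσ, Measure.map_map measurable_swap measurable_swap]; simp
    refine Eq.trans ?_ ((congrArg (Measure.map Prod.swap) hs).trans hsw)
    rw [Measure.map_map measurable_swap (by fun_prop)]
    rfl
  · have hs : (ν.compProd (ProbabilityTheory.Kernel.prod σ.condKernel ρ₂.condKernel)).map
        (Prod.map id Prod.snd) = ρ₂ := by
      rw [← Measure.compProd_map measurable_snd]
      rw [← ProbabilityTheory.Kernel.snd_eq, ProbabilityTheory.Kernel.snd_prod]
      nth_rewrite 1 [← hρν]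
      exact ρ₂.disintegrate ρ₂.condKernel
    exact hs

lemma intermediate_point_sq_le {X : Type*} [MetricSpace X] {x y z : X} {t : ℝ}
    (ht0 : 0 < t) (ht1 : t < 1) :
    dist x z ^ 2 ≤ t⁻¹ * dist x y ^ 2 + (1 - t)⁻¹ * dist y z ^ 2 := by
  have h1 : 0 < 1 - t := by linarith
  have htri := dist_triangle x y z
  have h2 : dist x z ^ 2 ≤ (dist x y + dist y z) ^ 2 := by gcongr
  have h3 : t⁻¹ * dist x y ^ 2 + (1 - t)⁻¹ * dist y z ^ 2 - (dist x y + dist y z) ^ 2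
      = ((1 - t) * dist x y - t * dist y z) ^ 2 / (t * (1 - t)) := by
    field_simp
    ring
  have h4 : 0 ≤ ((1 - t) * dist x y - t * dist y z) ^ 2 / (t * (1 - t)) := by positivity
  linarith

/-- Expanding both squares about the ideal values `t D` and `(1 - t) D`, where `D = dist x z`,
leaves `D²` plus nonnegative defects. A point `y` too far from `x` makes the first defect at least
`(s - t L)²`. -/
lemma intermediate_point_sq_add_le {X : Type*} [MetricSpace X] {x y z : X} {t L s : ℝ}
    (ht0 : 0 < t) (ht1 : t < 1)
    (hL : dist x z ≤ L) (hs : t * L < s) (hy : s ≤ dist x y) :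
    dist x z ^ 2 + (s - t * L) ^ 2 ≤ t⁻¹ * dist x y ^ 2 + (1 - t)⁻¹ * dist y z ^ 2 := by
  have h1 : 0 < 1 - t := by linarith
  set D := dist x z
  set a := dist x y
  set b := dist y z
  have hD : 0 ≤ D := dist_nonneg
  have htri : D ≤ a + b := dist_triangle x y z
  have hu : s - t * L ≤ a - t * D := by nlinarith
  have h2 : (s - t * L) ^ 2 ≤ (a - t * D) ^ 2 := by
    have : 0 ≤ s - t * L := by linarith
    gcongr
  have e1 : t⁻¹ * a ^ 2 = 2 * a * D - t * D ^ 2 + t⁻¹ * (a - t * D) ^ 2 := by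
    field_simp
    ring
  have e2 : (1 - t)⁻¹ * b ^ 2 = 2 * b * D - (1 - t) * D ^ 2
      + (1 - t)⁻¹ * (b - (1 - t) * D) ^ 2 := by
    field_simp
    ring
  have h3 : (a - t * D) ^ 2 ≤ t⁻¹ * (a - t * D) ^ 2 :=
    le_mul_of_one_le_left (sq_nonneg _) ((one_le_inv₀ ht0).2 ht1.le)
  have h4 : 0 ≤ (1 - t)⁻¹ * (b - (1 - t) * D) ^ 2 := by positivity
  nlinarith [mul_le_mul_of_nonneg_right htri hD]

variable {X : Type*} [MetricSpace X] [MeasurableSpace X]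

lemma wassersteinTwo_sq (μ ν : Measure X) : wassersteinTwo μ ν ^ 2 =
    ⨅ (π : Measure (X × X)) (_ : IsCoupling μ ν π), ∫⁻ p, edist p.1 p.2 ^ 2 ∂π := by
  rw [wassersteinTwo, ← ENNReal.rpow_natCast, ← ENNReal.rpow_mul]
  norm_num

lemma wassersteinTwo_sq_le {μ ν : Measure X} {π : Measure (X × X)} (h : IsCoupling μ ν π) :
    wassersteinTwo μ ν ^ 2 ≤ ∫⁻ p, edist p.1 p.2 ^ 2 ∂π := by
  rw [wassersteinTwo_sq]
  exact iInf₂_le π h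

lemma exists_coupling_lt {μ ν : Measure X} {a : ℝ≥0∞} (h : wassersteinTwo μ ν ^ 2 < a) :
    ∃ π, IsCoupling μ ν π ∧ ∫⁻ p, edist p.1 p.2 ^ 2 ∂π < a := by
  rw [wassersteinTwo_sq] at h
  simpa [iInf_lt_iff] using h

variable [CompleteSpace X] [SecondCountableTopology X] [BorelSpace X]

/-- Mass of `ν` outside the thickening would make passing through `ν` strictly costlier than `W₂²`,
by a fixed amount per unit mass. Almost optimal plans suffice, as their error `η` is arbitrary. -/
lemma measure_compl_thickening_eq_zero {μ₀ ν μ₁ : Measure X} [IsProbabilityMeasure ν]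
    {A B : Set X} (hμ₀ : ∀ᵐ x ∂μ₀, x ∈ A) (hμ₁ : ∀ᵐ z ∂μ₁, z ∈ B) {t L s : ℝ} (ht0 : 0 < t)
    (ht1 : t < 1) (hL : ∀ x ∈ A, ∀ z ∈ B, dist x z ≤ L) (hs : t * L < s)
    (hW : wassersteinTwo μ₀ μ₁ ≠ ∞)
    (h₀ : wassersteinTwo μ₀ ν ≤ ENNReal.ofReal t * wassersteinTwo μ₀ μ₁)
    (h₁ : wassersteinTwo ν μ₁ ≤ ENNReal.ofReal (1 - t) * wassersteinTwo μ₀ μ₁) :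
    ν (Metric.thickening s A)ᶜ = 0 := by
  have h1t : 0 < 1 - t := by linarith
  have : Nonempty X := nonempty_of_isProbabilityMeasure ν
  set N := (Metric.thickening s A)ᶜ with hN
  have hNm : MeasurableSet N := Metric.isOpen_thickening.measurableSet.compl
  set w := (wassersteinTwo μ₀ μ₁).toReal with hw
  have hw0 : 0 ≤ w := ENNReal.toReal_nonneg
  rw [← ENNReal.ofReal_toReal hW, ← hw] at h₀ h₁
  rw [← ENNReal.ofReal_mul ht0.le] at h₀
  rw [← ENNReal.ofReal_mul h1t.le] at h₁
  set c := (s - t * L) ^ 2 with hc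
  have hcpos : 0 < c := by
    have : 0 < s - t * L := by linarith
    positivity
  set β := (ν N).toReal with hβ
  have hβ0 : 0 ≤ β := ENNReal.toReal_nonneg
  set K := t⁻¹ + (1 - t)⁻¹ with hK
  have hKpos : 0 < K := by positivity
  have key : ∀ η : ℝ, 0 < η → w ^ 2 + c * β ≤ w ^ 2 + K * η := by
    intro η hη
    have hlt : ∀ r : ℝ, 0 ≤ r → ∀ q : ℝ≥0∞, q ≤ ENNReal.ofReal r →
        q ^ 2 < ENNReal.ofReal (r ^ 2 + η) := by
      intro r hr q hq
      calc q ^ 2 ≤ ENNReal.ofReal r ^ 2 := by gcongr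
        _ = ENNReal.ofReal (r ^ 2) := (ENNReal.ofReal_pow hr 2).symm
        _ < _ := (ENNReal.ofReal_lt_ofReal_iff (by positivity)).2 (by linarith)
    obtain ⟨ρ₁, hρ₁, hc₁⟩ := exists_coupling_lt (hlt _ (by positivity) _ h₀)
    obtain ⟨ρ₂, hρ₂, hc₂⟩ := exists_coupling_lt (hlt _ (by positivity) _ h₁)
    obtain ⟨P, hP₁, hP₂⟩ := exists_gluing hρ₁ hρ₂
    have m1 : Measurable (fun p : X × X × X => (p.2.1, p.1)) := by fun_prop
    have m2 : Measurable (fun p : X × X × X => (p.1, p.2.2)) := by fun_prop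
    have m3 : Measurable (fun p : X × X × X => (p.2.1, p.2.2)) := by fun_prop
    have me : Measurable (fun p : X × X => edist p.1 p.2 ^ 2) :=
      (measurable_edist).pow_const 2
    have m4 : Measurable (fun p : X × X × X => edist p.2.1 p.1 ^ 2) := me.comp m1
    have m5 : Measurable (fun p : X × X × X => edist p.1 p.2.2 ^ 2) := me.comp m2
    have hx : P.map (fun p => p.2.1) = μ₀ := by
      rw [← hρ₁.1, ← hP₁, Measure.map_map measurable_fst m1]; rfl
    have hy : P.map (fun p => p.1) = ν := by
      rw [← hρ₂.1, ← hP₂, Measure.map_map measurable_fst m2]; rfl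
    have hz : P.map (fun p => p.2.2) = μ₁ := by
      rw [← hρ₂.2, ← hP₂, Measure.map_map measurable_snd m2]; rfl
    have hxA : ∀ᵐ p ∂P, p.2.1 ∈ A := by
      rw [← hx] at hμ₀
      exact ae_of_ae_map (by fun_prop) hμ₀
    have hzB : ∀ᵐ p ∂P, p.2.2 ∈ B := by
      rw [← hz] at hμ₁
      exact ae_of_ae_map (by fun_prop) hμ₁
    have hxz : IsCoupling μ₀ μ₁ (P.map fun p => (p.2.1, p.2.2)) := by
      constructor
      · rw [← hx, Measure.map_map measurable_fst m3]; rfl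
      · rw [← hz, Measure.map_map measurable_snd m3]; rfl
    have i1 : ∫⁻ p, edist p.2.1 p.1 ^ 2 ∂P = ∫⁻ q, edist q.1 q.2 ^ 2 ∂ρ₁ := by
      rw [← hP₁, lintegral_map me m1]
    have i2 : ∫⁻ p, edist p.1 p.2.2 ^ 2 ∂P = ∫⁻ q, edist q.1 q.2 ^ 2 ∂ρ₂ := by
      rw [← hP₂, lintegral_map me m2]
    have i3 : ENNReal.ofReal (w ^ 2) ≤ ∫⁻ p, edist p.2.1 p.2.2 ^ 2 ∂P := by
      have := wassersteinTwo_sq_le hxz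
      rwa [lintegral_map me m3, ← ENNReal.ofReal_toReal hW, ← hw,
        ← ENNReal.ofReal_pow hw0] at this
    have i4 : ∫⁻ p, N.indicator (fun _ => ENNReal.ofReal c) p.1 ∂P = ENNReal.ofReal (c * β) := by
      have : ∫⁻ y, N.indicator (fun _ => ENNReal.ofReal c) y ∂ν = ENNReal.ofReal (c * β) := by
        rw [lintegral_indicator hNm, lintegral_const, Measure.restrict_apply_univ,
          ENNReal.ofReal_mul hcpos.le, hβ, ENNReal.ofReal_toReal (measure_ne_top _ _)]
      rw [← this, ← hy, lintegral_map (measurable_const.indicator hNm) (by fun_prop)]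
    have hpt : ∀ᵐ p ∂P, edist p.2.1 p.2.2 ^ 2 + N.indicator (fun _ => ENNReal.ofReal c) p.1
        ≤ ENNReal.ofReal t⁻¹ * edist p.2.1 p.1 ^ 2
          + ENNReal.ofReal (1 - t)⁻¹ * edist p.1 p.2.2 ^ 2 := by
      filter_upwards [hxA, hzB] with p hpA hpB
      simp only [edist_dist]
      rw [← ENNReal.ofReal_pow dist_nonneg, ← ENNReal.ofReal_pow dist_nonneg,
        ← ENNReal.ofReal_pow dist_nonneg, ← ENNReal.ofReal_mul (by positivity),
        ← ENNReal.ofReal_mul (by positivity), ← ENNReal.ofReal_add (by positivity) (by positivity)]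
      by_cases hp : p.1 ∈ N
      · rw [Set.indicator_of_mem hp, ← ENNReal.ofReal_add (by positivity) hcpos.le]
        apply ENNReal.ofReal_le_ofReal
        refine intermediate_point_sq_add_le ht0 ht1 (hL _ hpA _ hpB) hs ?_
        by_contra hlt'
        exact hp (Metric.mem_thickening_iff.2 ⟨_, hpA, by rw [dist_comm]; exact not_le.1 hlt'⟩)
      · rw [Set.indicator_of_notMem hp, add_zero]
        exact ENNReal.ofReal_le_ofReal (intermediate_point_sq_le ht0 ht1)
    have hint : ENNReal.ofReal (w ^ 2) + ENNReal.ofReal (c * β)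
        ≤ ENNReal.ofReal t⁻¹ * ENNReal.ofReal ((t * w) ^ 2 + η)
          + ENNReal.ofReal (1 - t)⁻¹ * ENNReal.ofReal (((1 - t) * w) ^ 2 + η) := by
      calc _ ≤ ∫⁻ p, edist p.2.1 p.2.2 ^ 2 ∂P
            + ∫⁻ p, N.indicator (fun _ => ENNReal.ofReal c) p.1 ∂P := by rw [i4]; gcongr
        _ = ∫⁻ p, (edist p.2.1 p.2.2 ^ 2
            + N.indicator (fun _ => ENNReal.ofReal c) p.1) ∂P :=
          (lintegral_add_left (me.comp m3) _).symm
        _ ≤ _ := lintegral_mono_ae hpt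
        _ = ENNReal.ofReal t⁻¹ * ∫⁻ q, edist q.1 q.2 ^ 2 ∂ρ₁
            + ENNReal.ofReal (1 - t)⁻¹ * ∫⁻ q, edist q.1 q.2 ^ 2 ∂ρ₂ := by
          rw [lintegral_add_left (m4.const_mul _), lintegral_const_mul _ m4,
            lintegral_const_mul _ m5, i1, i2]
        _ ≤ _ := by gcongr
    rw [← ENNReal.ofReal_mul (by positivity), ← ENNReal.ofReal_mul (by positivity),
      ← ENNReal.ofReal_add (by positivity) (by positivity),
      ← ENNReal.ofReal_add (by positivity) (by positivity),
      ENNReal.ofReal_le_ofReal_iff (by positivity)] at hint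
    calc _ ≤ _ := hint
      _ = _ := by rw [hK]; field_simp; ring
  have hβz : β = 0 := by
    by_contra hne
    have hβp : 0 < β := lt_of_le_of_ne hβ0 (Ne.symm hne)
    have := key (c * β / (2 * K)) (by positivity)
    have e : K * (c * β / (2 * K)) = c * β / 2 := by field_simp
    rw [e] at this
    have : 0 < c * β := by positivity
    linarith
  rcases (ENNReal.toReal_eq_zero_iff _).1 hβz with h | h
  · exact h
  · exact absurd h (measure_ne_top _ _)

end Transport

/-! ### Brunn-Minkowski inequality and finiteness of balls -/

section BrunnMinkowski

lemma thickening_subset_ball {X : Type*} [MetricSpace X] {A : Set X} {x₀ : X} {D ε : ℝ}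
    (hA : A ⊆ Metric.ball x₀ D) :
    Metric.thickening ε A ⊆ Metric.ball x₀ (D + ε) := by
  intro y hy
  obtain ⟨z, hz, hyz⟩ := Metric.mem_thickening_iff.1 hy
  have := hA hz
  rw [Metric.mem_ball] at this ⊢
  linarith [dist_triangle y z x₀]

lemma memP2_cond {X : Type*} [MetricSpace X] [MeasurableSpace X] (m : Measure X)
    {A : Set X} (hA : MeasurableSet A) (h0 : m A ≠ 0)
    (hT : m A ≠ ∞) {z : X} {L : ℝ} (hL : ∀ x ∈ A, dist x z ≤ L) :
    MemP2 (ProbabilityTheory.cond m A) := by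
  have := ProbabilityTheory.cond_isProbabilityMeasure_of_finite h0 hT
  refine ⟨this, z, ?_⟩
  calc ∫⁻ x, edist x z ^ 2 ∂(ProbabilityTheory.cond m A)
      ≤ ∫⁻ _, ENNReal.ofReal L ^ 2 ∂(ProbabilityTheory.cond m A) := by
        apply lintegral_mono_ae
        filter_upwards [ProbabilityTheory.ae_cond_mem hA] with x hx
        rw [edist_dist]
        gcongr
        exact hL x hx
    _ < ∞ := by simp

lemma wassersteinTwo_ne_top {X : Type*} [MetricSpace X] [SecondCountableTopology X]
    [MeasurableSpace X] [BorelSpace X] {μ₀ μ₁ : Measure X} [IsProbabilityMeasure μ₀]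
    [IsProbabilityMeasure μ₁] {A B : Set X} (hμ₀ : ∀ᵐ x ∂μ₀, x ∈ A) (hμ₁ : ∀ᵐ z ∂μ₁, z ∈ B)
    {L : ℝ} (hL : ∀ x ∈ A, ∀ z ∈ B, dist x z ≤ L) : wassersteinTwo μ₀ μ₁ ≠ ∞ := by
  have hcpl : IsCoupling μ₀ μ₁ (μ₀.prod μ₁) := by
    constructor
    · rw [Measure.map_fst_prod]; simp
    · rw [Measure.map_snd_prod]; simp
  have h1 : ∫⁻ p, edist p.1 p.2 ^ 2 ∂(μ₀.prod μ₁) ≤ ENNReal.ofReal L ^ 2 := by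
    rw [lintegral_prod _ (measurable_edist.pow_const 2).aemeasurable]
    calc ∫⁻ x, ∫⁻ z, edist x z ^ 2 ∂μ₁ ∂μ₀ ≤ ∫⁻ _, ∫⁻ _, ENNReal.ofReal L ^ 2 ∂μ₁ ∂μ₀ := by
          apply lintegral_mono_ae
          filter_upwards [hμ₀] with x hx
          apply lintegral_mono_ae
          filter_upwards [hμ₁] with z hz
          rw [edist_dist]
          gcongr
          exact hL x hx z hz
      _ = _ := by simp
  intro h
  have h2 := (wassersteinTwo_sq_le hcpl).trans h1
  rw [h] at h2
  simp at h2

variable {X : Type*} [MetricSpace X] [CompleteSpace X] [SecondCountableTopology X]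
  [MeasurableSpace X] [BorelSpace X]

/-- A form of the Brunn-Minkowski inequality. -/
lemma log_measure_thickening_ge {m : Measure X} [SigmaFinite m] (hCD : IsCDZeroInfty m)
    {A B : Set X} (hA : MeasurableSet A) (hB : MeasurableSet B) (hA0 : m A ≠ 0) (hAT : m A ≠ ∞)
    (hB0 : m B ≠ 0) (hBT : m B ≠ ∞) {t L s : ℝ} (ht0 : 0 < t) (ht1 : t < 1)
    (hL : ∀ x ∈ A, ∀ z ∈ B, dist x z ≤ L) (hs : t * L < s)
    (hfin : m (Metric.thickening s A) ≠ ∞) :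
    (1 - t) * Real.log (m A).toReal + t * Real.log (m B).toReal
      ≤ Real.log (m (Metric.thickening s A)).toReal := by
  obtain ⟨a, ha⟩ := nonempty_of_measure_ne_zero hA0
  obtain ⟨b, hb⟩ := nonempty_of_measure_ne_zero hB0
  have pA := ProbabilityTheory.cond_isProbabilityMeasure_of_finite hA0 hAT
  have pB := ProbabilityTheory.cond_isProbabilityMeasure_of_finite hB0 hBT
  have aeA := ProbabilityTheory.ae_cond_mem (μ := m) hA
  have aeB := ProbabilityTheory.ae_cond_mem (μ := m) hB
  obtain ⟨γ, ⟨hγ0, hγ1, hγP, hγW⟩, hent⟩ := hCD _ _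
    (memP2_cond m hA hA0 hAT fun x hx => hL x hx b hb)
    (memP2_cond m hB hB0 hBT fun x hx => by rw [dist_comm]; exact hL a ha x hx)
  have htI : t ∈ Set.Icc (0 : ℝ) 1 := ⟨ht0.le, ht1.le⟩
  have := (hγP t htI).1
  have hW0 := hγW 0 (by simp) t htI
  have hW1 := hγW t htI 1 (by simp)
  rw [hγ0, sub_zero, abs_of_pos ht0] at hW0
  rw [hγ1, abs_of_pos (by linarith)] at hW1
  have hzero := measure_compl_thickening_eq_zero aeA aeB ht0 ht1 hL hs
    (wassersteinTwo_ne_top aeA aeB hL) hW0.le hW1.le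
  have he := hent (by rw [relEntropy_cond m hA hA0 hAT]; exact EReal.coe_lt_top _)
    (by rw [relEntropy_cond m hB hB0 hBT]; exact EReal.coe_lt_top _) t htI
  rw [relEntropy_cond m hA hA0 hAT, relEntropy_cond m hB hB0 hBT, ← EReal.coe_mul,
    ← EReal.coe_mul, ← EReal.coe_add] at he
  have := neg_log_measure_le_of_relEntropy_le m (γ t)
    Metric.isOpen_thickening.measurableSet hzero hfin he
  linarith

/-- A ball of infinite measure contains sets `B` of arbitrarily large finite measure. With `A` a
small ball and `t` fixed, Brunn-Minkowski bounds `m(B)` by the measure of a small thickening, which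
local finiteness makes finite. -/
lemma measure_ball_ne_top_of_isCD {m : Measure X} [IsLocallyFiniteMeasure m]
    [m.IsOpenPosMeasure]
    (hCD : IsCDZeroInfty m) (x₀ : X) (R : ℝ) : m (Metric.ball x₀ R) ≠ ∞ := by
  obtain ⟨U, hU, hUfin⟩ := m.finiteAt_nhds x₀
  obtain ⟨ε, hε, hεU⟩ := Metric.mem_nhds_iff.1 hU
  have hfin : ∀ r ≤ ε, m (Metric.ball x₀ r) ≠ ∞ := fun r hr =>
    ((measure_mono ((Metric.ball_subset_ball hr).trans hεU)).trans_lt hUfin).ne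
  set δ := ε / 2 with hδ
  have hδ0 : 0 < δ := by positivity
  have hT : m (Metric.thickening δ (Metric.ball x₀ δ)) ≠ ∞ :=
    ((measure_mono (thickening_subset_ball subset_rfl)).trans_lt
      (hfin (δ + δ) (by linarith)).lt_top).ne
  intro hR
  set L := δ + |R| with hLdef
  have hLpos : 0 < L := by positivity
  set t := δ / (2 * L) with ht
  have ht0 : 0 < t := by positivity
  have ht1 : t < 1 := by
    rw [ht, div_lt_one (by positivity)]
    linarith [abs_nonneg R]
  have htL : t * L < δ := by
    have : t * L = δ / 2 := by rw [ht]; field_simp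
    linarith
  -- The largest value of `ln m(B)` that Brunn-Minkowski allows.
  set y := (Real.log (m (Metric.thickening δ (Metric.ball x₀ δ))).toReal
    - (1 - t) * Real.log (m (Metric.ball x₀ δ)).toReal) / t with hy
  obtain ⟨B, hB, hBR, hBy, hBT⟩ := Measure.exists_subset_measure_lt_top
    (μ := m) (Metric.isOpen_ball (x := x₀) (ε := R)).measurableSet
    (r := ENNReal.ofReal (Real.exp y)) (by rw [hR]; exact ENNReal.ofReal_lt_top)
  have hL : ∀ x ∈ Metric.ball x₀ δ, ∀ z ∈ B, dist x z ≤ L := by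
    intro x hx z hz
    have h1 := hBR hz
    rw [Metric.mem_ball] at hx h1
    linarith [dist_triangle_right x z x₀, le_abs_self R]
  have key := log_measure_thickening_ge hCD Metric.isOpen_ball.measurableSet hB
    (Metric.measure_ball_pos m x₀ hδ0).ne' (hfin δ (by linarith))
    (pos_of_gt hBy).ne' hBT.ne ht0 ht1 hL htL hT
  have hlog : y < Real.log (m B).toReal := by
    rw [Real.lt_log_iff_exp_lt (ENNReal.toReal_pos (pos_of_gt hBy).ne' hBT.ne)]
    exact (ENNReal.ofReal_lt_iff_lt_toReal (Real.exp_pos y).le hBT.ne).1 hBy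
  have h2 : t * y < t * Real.log (m B).toReal := by gcongr
  have h3 : t * y = Real.log (m (Metric.thickening δ (Metric.ball x₀ δ))).toReal
    - (1 - t) * Real.log (m (Metric.ball x₀ δ)).toReal := by rw [hy]; field_simp
  linarith

lemma log_measure_thickening_sub_ge {m : Measure X} [IsLocallyFiniteMeasure m]
    [m.IsOpenPosMeasure] (hCD : IsCDZeroInfty m) {A : Set X} (hA : MeasurableSet A)
    (hA0 : m A ≠ 0) {x₀ : X} {D ε R : ℝ} (hAD : A ⊆ Metric.ball x₀ D) (hε : 0 < ε) (hR : 0 < R)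
    (hεR : ε ≤ R + D) :
    ε * (Real.log (m (Metric.ball x₀ R)).toReal - Real.log (m A).toReal)
      ≤ (R + D) * (Real.log (m (Metric.thickening ε A)).toReal - Real.log (m A).toReal) := by
  have hL0 : 0 < R + D := hε.trans_le hεR
  have hAT : m A ≠ ∞ :=
    ((measure_mono hAD).trans_lt (measure_ball_ne_top_of_isCD hCD x₀ D).lt_top).ne
  have hT : m (Metric.thickening ε A) ≠ ∞ :=
    ((measure_mono (thickening_subset_ball hAD)).trans_lt
      (measure_ball_ne_top_of_isCD hCD x₀ _).lt_top).ne
  have hL : ∀ x ∈ A, ∀ z ∈ Metric.ball x₀ R, dist x z ≤ R + D := by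
    intro x hx z hz
    have h1 := hAD hx
    rw [Metric.mem_ball] at h1 hz
    linarith [dist_triangle_right x z x₀]
  -- Brunn-Minkowski needs `t L < ε` strictly, so `t = τ / (R + D)` is used with `τ` increasing to
  -- `ε`.
  refine le_of_tendsto (x := 𝓝[<] ε)
    (f := fun τ => τ * (Real.log (m (Metric.ball x₀ R)).toReal - Real.log (m A).toReal)) ?_ ?_
  · exact ((continuous_id.mul continuous_const).tendsto ε).mono_left nhdsWithin_le_nhds
  · filter_upwards [Ioo_mem_nhdsLT hε] with τ hτ
    have key := log_measure_thickening_ge hCD hA Metric.isOpen_ball.measurableSet hA0 hAT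
      (Metric.measure_ball_pos m x₀ hR).ne' (measure_ball_ne_top_of_isCD hCD x₀ R)
      (t := τ / (R + D)) (div_pos hτ.1 hL0) ((div_lt_one hL0).2 (hτ.2.trans_le hεR)) hL
      (by rw [div_mul_cancel₀ _ hL0.ne']; exact hτ.2) hT
    have h2 : τ / (R + D) * (Real.log (m (Metric.ball x₀ R)).toReal - Real.log (m A).toReal)
        ≤ Real.log (m (Metric.thickening ε A)).toReal - Real.log (m A).toReal := by linarith
    have h3 := mul_le_mul_of_nonneg_left h2 hL0.le
    rwa [← mul_assoc, mul_div_cancel₀ _ hL0.ne'] at h3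

end BrunnMinkowski

/-! ### Growth of monotone real functions -/

section RealGrowth

/-- As in Fekete's lemma, the slope `g` from `1` converges to its infimum: the hypothesis reads `g R
≤ g s * (1 + 2 / (R - 1))`, and the factor tends to `1`. -/
lemma exists_tendsto_div_of_quasiconcave {f : ℝ → ℝ} (hmono : MonotoneOn f (Set.Ioi 0))
    (hf : ∀ s R : ℝ, 1 < s → s ≤ R → (s - 1) * (f R - f 1) ≤ (R + 1) * (f s - f 1)) :
    ∃ h : ℝ, 0 ≤ h ∧ Tendsto (fun r => f r / r) atTop (𝓝 h) := by
  set g : ℝ → ℝ := fun s => (f s - f 1) / (s - 1) with hg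
  have hg0 : ∀ s ∈ Set.Ioi (1 : ℝ), 0 ≤ g s := by
    intro s hs
    rw [Set.mem_Ioi] at hs
    have : f 1 ≤ f s := hmono (Set.mem_Ioi.2 one_pos) (Set.mem_Ioi.2 (by linarith)) hs.le
    exact div_nonneg (by linarith) (by linarith)
  have hbdd : BddBelow (g '' Set.Ioi 1) := ⟨0, by rintro _ ⟨s, hs, rfl⟩; exact hg0 s hs⟩
  have hne : (g '' Set.Ioi 1).Nonempty := ⟨g 2, 2, by norm_num, rfl⟩
  set h := sInf (g '' Set.Ioi 1) with hh
  have hgt : Tendsto g atTop (𝓝 h) := by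
    rw [tendsto_order]
    constructor
    · intro a ha
      filter_upwards [eventually_gt_atTop 1] with R hR
      exact ha.trans_le (csInf_le hbdd ⟨R, hR, rfl⟩)
    · intro c hc
      obtain ⟨_, ⟨s, hs, rfl⟩, hsc⟩ := (csInf_lt_iff hbdd hne).1 hc
      have hs' : 1 < s := hs
      have hlim : Tendsto (fun R : ℝ => g s * (1 + 2 / (R - 1))) atTop (𝓝 (g s * (1 + 0))) :=
        (tendsto_const_nhds.add (Tendsto.const_div_atTop
          (tendsto_atTop_add_const_right _ _ tendsto_id) 2)).const_mul _
      rw [add_zero, mul_one] at hlim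
      filter_upwards [hlim.eventually_lt_const hsc, eventually_ge_atTop s] with R hR1 hR2
      refine lt_of_le_of_lt ?_ hR1
      have hRpos : 0 < R - 1 := by linarith
      have hspos : 0 < s - 1 := by linarith
      have := hf s R hs' hR2
      simp only [hg]
      rw [div_le_iff₀ hRpos]
      have e : (f s - f 1) / (s - 1) * (1 + 2 / (R - 1)) * (R - 1)
          = (R + 1) * (f s - f 1) / (s - 1) := by
        field_simp
        ring
      rw [e, le_div_iff₀ hspos]
      linarith
  refine ⟨h, le_csInf hne (by rintro _ ⟨s, hs, rfl⟩; exact hg0 s hs), ?_⟩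
  have h1 : Tendsto (fun R : ℝ => g R * (1 - 1 / R) + f 1 / R) atTop (𝓝 (h * (1 - 0) + 0)) :=
    (hgt.mul (tendsto_const_nhds.sub (tendsto_id.const_div_atTop 1))).add
      (tendsto_id.const_div_atTop _)
  rw [sub_zero, mul_one, add_zero] at h1
  refine h1.congr' ?_
  filter_upwards [eventually_gt_atTop 1] with R hR
  have hRpos : 0 < R - 1 := by linarith
  simp only [hg]
  field_simp
  ring

/-- Continuous induction: monotonicity, in place of continuity, lets the bound pass to the supremum
of the good radii, and the local growth then pushes past it. -/
lemma add_mul_le_of_forall_exists_lt {f : ℝ → ℝ} {c : ℝ} (hmono : MonotoneOn f (Set.Ioi 0))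
    (hc : 0 < c)
    (hf : ∀ r > 0, ∀ δ > 0, ∃ ε > 0, ε < δ ∧ f r + c * ε ≤ f (r + ε)) {r : ℝ} (hr : 1 ≤ r) :
    f 1 + c * (r - 1) ≤ f r := by
  set S : Set ℝ := {s | s ∈ Set.Icc 1 r ∧ f 1 + c * (s - 1) ≤ f s} with hS
  have h1 : (1 : ℝ) ∈ S := ⟨⟨le_rfl, hr⟩, by simp⟩
  have hbdd : BddAbove S := ⟨r, fun s hs => hs.1.2⟩
  set σ := sSup S with hσ
  have hσ1 : 1 ≤ σ := le_csSup hbdd h1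
  have hσr : σ ≤ r := csSup_le ⟨1, h1⟩ fun s hs => hs.1.2
  have hσS : f 1 + c * (σ - 1) ≤ f σ := by
    apply le_of_forall_pos_lt_add
    intro η hη
    obtain ⟨s, hs, hsσ⟩ := exists_lt_of_lt_csSup ⟨1, h1⟩
      (show σ - η / c < sSup S by linarith [div_pos hη hc])
    have h2 : f s ≤ f σ := hmono (Set.mem_Ioi.2 (by linarith [hs.1.1]))
      (Set.mem_Ioi.2 (by linarith)) (le_csSup hbdd hs)
    have h3 : c * (σ - η / c) < c * s := by gcongr
    have h4 : c * (σ - η / c) = c * σ - η := by field_simp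
    linarith [hs.2]
  rcases hσr.eq_or_lt with h | h
  · rwa [h] at hσS
  · obtain ⟨ε, hε, hεr, hε2⟩ := hf σ (by linarith) (r - σ) (by linarith)
    have : σ + ε ∈ S := ⟨⟨by linarith, by linarith⟩, by linarith⟩
    linarith [le_csSup hbdd this]

end RealGrowth

/-! ### Volume entropy and isoperimetry -/

section VolumeEntropy

lemma log_measure_mono {X : Type*} [MeasurableSpace X] {m : Measure X}
    {A B : Set X} (hA : m A ≠ 0) (hB : m B ≠ ∞) (hAB : A ⊆ B) :
    Real.log (m A).toReal ≤ Real.log (m B).toReal :=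
  Real.log_le_log (ENNReal.toReal_pos hA (measure_ne_top_of_subset hAB hB))
    (ENNReal.toReal_mono hB (measure_mono hAB))

variable {X : Type*} [MetricSpace X] [CompleteSpace X] [SecondCountableTopology X]
  [MeasurableSpace X] [BorelSpace X] {m : Measure X} [IsLocallyFiniteMeasure m]
  [m.IsOpenPosMeasure]

lemma monotoneOn_log_measure_ball (hCD : IsCDZeroInfty m) (x₀ : X) :
    MonotoneOn (fun r => Real.log (m (Metric.ball x₀ r)).toReal) (Set.Ioi 0) := fun _ hr s _ hrs =>
  log_measure_mono (Metric.measure_ball_pos m x₀ hr).ne' (measure_ball_ne_top_of_isCD hCD x₀ s)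
    (Metric.ball_subset_ball hrs)

lemma exists_tendsto_log_measure_ball_div (hCD : IsCDZeroInfty m) (x₀ : X) :
    ∃ h : ℝ, 0 ≤ h ∧
      Tendsto (fun r => Real.log (m (Metric.ball x₀ r)).toReal / r) atTop (𝓝 h) := by
  refine exists_tendsto_div_of_quasiconcave (monotoneOn_log_measure_ball hCD x₀) ?_
  intro s R hs hsR
  have h1 := (Metric.measure_ball_pos m x₀ one_pos).ne'
  have key := log_measure_thickening_sub_ge hCD Metric.isOpen_ball.measurableSet h1
    (subset_refl (Metric.ball x₀ 1)) (ε := s - 1) (R := R) (by linarith) (by linarith)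
    (by linarith)
  have hmon : Real.log (m (Metric.thickening (s - 1) (Metric.ball x₀ 1))).toReal
      ≤ Real.log (m (Metric.ball x₀ s)).toReal := by
    refine log_measure_mono (fun h => h1 ?_) (measure_ball_ne_top_of_isCD hCD x₀ s) ?_
    · exact measure_mono_null (Metric.self_subset_thickening (by linarith) _) h
    · have := thickening_subset_ball (ε := s - 1) (subset_refl (Metric.ball x₀ 1))
      rwa [add_sub_cancel] at this
  refine key.trans ?_
  have : 0 ≤ R + 1 := by linarith
  gcongr

/-- Since `B_r(x₁) ⊆ B_{r+d}(x₀)`, moving the centre only shifts the radius. Used in both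
directions, this gives independence of the base point. -/
lemma tendsto_log_measure_ball_le (hCD : IsCDZeroInfty m) {x₀ x₁ : X} {h₀ h₁ : ℝ}
    (H₀ : Tendsto (fun r => Real.log (m (Metric.ball x₀ r)).toReal / r) atTop (𝓝 h₀))
    (H₁ : Tendsto (fun r => Real.log (m (Metric.ball x₁ r)).toReal / r) atTop (𝓝 h₁)) :
    h₁ ≤ h₀ := by
  set d := dist x₁ x₀ with hd
  have hlim : Tendsto (fun r : ℝ => Real.log (m (Metric.ball x₀ (r + d))).toReal / (r + d)
      * (1 + d / r)) atTop (𝓝 (h₀ * (1 + 0))) :=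
    (H₀.comp (tendsto_atTop_add_const_right _ d tendsto_id)).mul
      (tendsto_const_nhds.add (tendsto_id.const_div_atTop d))
  rw [add_zero, mul_one] at hlim
  refine le_of_tendsto_of_tendsto H₁ hlim ?_
  filter_upwards [eventually_gt_atTop 0] with r hr
  have hd0 : 0 ≤ d := dist_nonneg
  have e : Real.log (m (Metric.ball x₀ (r + d))).toReal / (r + d) * (1 + d / r)
      = Real.log (m (Metric.ball x₀ (r + d))).toReal / r := by
    field_simp
  rw [e]
  refine div_le_div_of_nonneg_right ?_ hr.le
  refine log_measure_mono (Metric.measure_ball_pos m x₁ hr).ne'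
    (measure_ball_ne_top_of_isCD hCD _ _) ?_
  exact Metric.ball_subset_ball' (by rw [hd])

lemma exists_forall_tendsto_log_measure_ball_div [Nonempty X] (hCD : IsCDZeroInfty m) :
    ∃ h : ℝ, 0 ≤ h ∧ ∀ x₀ : X,
      Tendsto (fun r => Real.log (m (Metric.ball x₀ r)).toReal / r) atTop (𝓝 h) := by
  obtain ⟨x₁⟩ := ‹Nonempty X›
  obtain ⟨h, h0, hh⟩ := exists_tendsto_log_measure_ball_div hCD x₁
  refine ⟨h, h0, fun x₀ => ?_⟩
  obtain ⟨k, -, hk⟩ := exists_tendsto_log_measure_ball_div hCD x₀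
  rwa [(tendsto_log_measure_ball_le hCD hh hk).antisymm
    (tendsto_log_measure_ball_le hCD hk hh)] at hk

lemma hasVolumeEntropyAt_of_tendsto (hCD : IsCDZeroInfty m) {x₀ : X} {h : ℝ} (h0 : 0 ≤ h)
    (hh : Tendsto (fun r => Real.log (m (Metric.ball x₀ r)).toReal / r) atTop (𝓝 h)) :
    HasVolumeEntropyAt m x₀ (ENNReal.ofReal h) := by
  unfold HasVolumeEntropyAt
  rw [EReal.coe_ennreal_ofReal, max_eq_left h0]
  refine ((continuous_coe_real_ereal.tendsto h).comp hh).congr' ?_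
  filter_upwards [eventually_gt_atTop 0] with r hr
  rw [ENNReal.log_pos_real (Metric.measure_ball_pos m x₀ hr).ne'
    (measure_ball_ne_top_of_isCD hCD x₀ r)]
  simp [EReal.coe_div]

lemma ofReal_mul_measure_le_measure_thickening_of_bounded (hCD : IsCDZeroInfty m) {x₀ : X}
    {h : ℝ} (h0 : 0 ≤ h)
    (hh : Tendsto (fun r => Real.log (m (Metric.ball x₀ r)).toReal / r) atTop (𝓝 h))
    {A : Set X} (hA : MeasurableSet A) {D ε : ℝ} (hAD : A ⊆ Metric.ball x₀ D) (hε : 0 < ε) :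
    ENNReal.ofReal (1 + h * ε) * m A ≤ m (Metric.thickening ε A) := by
  by_cases hA0 : m A = 0
  · simp [hA0]
  have hAT : m A ≠ ∞ := measure_ne_top_of_subset hAD (measure_ball_ne_top_of_isCD hCD x₀ D)
  have hT : m (Metric.thickening ε A) ≠ ∞ :=
    measure_ne_top_of_subset (thickening_subset_ball hAD) (measure_ball_ne_top_of_isCD hCD x₀ _)
  have hT0 : m (Metric.thickening ε A) ≠ 0 := fun h' =>
    hA0 (measure_mono_null (Metric.self_subset_thickening hε _) h')
  set a := Real.log (m A).toReal with ha
  set b := Real.log (m (Metric.thickening ε A)).toReal with hb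
  have hlim : Tendsto (fun R : ℝ =>
      ε * (Real.log (m (Metric.ball x₀ R)).toReal / R - a / R)) atTop (𝓝 (ε * (h - 0))) :=
    (hh.sub (tendsto_id.const_div_atTop a)).const_mul ε
  have hlim2 : Tendsto (fun R : ℝ => (1 + D / R) * (b - a)) atTop (𝓝 ((1 + 0) * (b - a))) :=
    (tendsto_const_nhds.add (tendsto_id.const_div_atTop D)).mul_const _
  have hle : ε * (h - 0) ≤ (1 + 0) * (b - a) := by
    refine le_of_tendsto_of_tendsto hlim hlim2 ?_
    filter_upwards [eventually_gt_atTop 0, eventually_ge_atTop (ε - D)] with R hR hR2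
    have key := log_measure_thickening_sub_ge hCD hA hA0 hAD hε hR (by linarith)
    have e1 : ε * (Real.log (m (Metric.ball x₀ R)).toReal / R - a / R)
        = ε * (Real.log (m (Metric.ball x₀ R)).toReal - a) / R := by ring
    have e2 : (1 + D / R) * (b - a) = (R + D) * (b - a) / R := by field_simp
    rw [e1, e2]
    gcongr
  have hab : a + h * ε ≤ b := by linarith
  have hexp := Real.exp_le_exp.2 hab
  rw [Real.exp_add, ha, hb, Real.exp_log (ENNReal.toReal_pos hA0 hAT),
    Real.exp_log (ENNReal.toReal_pos hT0 hT)] at hexp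
  rw [← ENNReal.ofReal_toReal hAT, ← ENNReal.ofReal_toReal hT,
    ← ENNReal.ofReal_mul (by positivity)]
  apply ENNReal.ofReal_le_ofReal
  refine le_trans ?_ hexp
  rw [mul_comm]
  gcongr
  linarith [Real.add_one_le_exp (h * ε)]

/-- The bounded case passes to increasing unions at fixed `ε`; the exhaustion thus precedes the
liminf defining `m⁺`. -/
lemma ofReal_mul_measure_le_measure_thickening (hCD : IsCDZeroInfty m) {x₀ : X}
    {h : ℝ} (h0 : 0 ≤ h)
    (hh : Tendsto (fun r => Real.log (m (Metric.ball x₀ r)).toReal / r) atTop (𝓝 h))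
    {Ω : Set X} (hΩ : MeasurableSet Ω) {ε : ℝ} (hε : 0 < ε) :
    ENNReal.ofReal (1 + h * ε) * m Ω ≤ m (Metric.thickening ε Ω) := by
  have hU : ⋃ n : ℕ, Ω ∩ Metric.ball x₀ n = Ω := by
    rw [← Set.inter_iUnion, Metric.iUnion_ball_nat, Set.inter_univ]
  have hlim : Tendsto (fun n : ℕ => m (Ω ∩ Metric.ball x₀ n)) atTop (𝓝 (m Ω)) := by
    have := tendsto_measure_iUnion_atTop (μ := m) (s := fun n : ℕ => Ω ∩ Metric.ball x₀ n)
      (fun i j hij => Set.inter_subset_inter_right _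
        (Metric.ball_subset_ball (by exact_mod_cast hij)))
    rwa [hU] at this
  refine le_of_tendsto' (ENNReal.Tendsto.const_mul hlim (Or.inr ENNReal.ofReal_ne_top)) fun n => ?_
  exact (ofReal_mul_measure_le_measure_thickening_of_bounded hCD h0 hh
    (hΩ.inter Metric.isOpen_ball.measurableSet) Set.inter_subset_right hε).trans
    (measure_mono (Metric.thickening_subset_of_subset _ Set.inter_subset_left))

lemma ofReal_mul_measure_le_minkowskiContent (hCD : IsCDZeroInfty m) {x₀ : X}
    {h : ℝ} (h0 : 0 ≤ h)
    (hh : Tendsto (fun r => Real.log (m (Metric.ball x₀ r)).toReal / r) atTop (𝓝 h))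
    {Ω : Set X} (hΩ : MeasurableSet Ω) (hT : m Ω ≠ ∞) :
    ENNReal.ofReal h * m Ω ≤ minkowskiContent m Ω := by
  refine le_liminf_of_le (by isBoundedDefault) ?_
  filter_upwards [self_mem_nhdsWithin] with ε hε
  have hε0 : 0 < ε := hε
  rw [ENNReal.le_div_iff_mul_le (Or.inl (by simpa using hε0)) (Or.inl ENNReal.ofReal_ne_top)]
  apply ENNReal.le_sub_of_add_le_left hT
  refine le_trans (le_of_eq ?_) (ofReal_mul_measure_le_measure_thickening hCD h0 hh hΩ hε0)
  rw [ENNReal.ofReal_add zero_le_one (by positivity), ENNReal.ofReal_mul h0, ENNReal.ofReal_one]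
  ring

lemma exists_minkowskiContent_ball_lt (hCD : IsCDZeroInfty m) {x₀ : X} {h C : ℝ} (h0 : 0 ≤ h)
    (hh : Tendsto (fun r => Real.log (m (Metric.ball x₀ r)).toReal / r) atTop (𝓝 h))
    (hC : h < C) :
    ∃ r > 0, minkowskiContent m (Metric.ball x₀ r) < ENNReal.ofReal C * m (Metric.ball x₀ r) := by
  by_contra! hcon
  set f : ℝ → ℝ := fun r => Real.log (m (Metric.ball x₀ r)).toReal with hf
  -- The gap from `C` to `b` makes the liminf bound strict; the gap from `b` to `c` absorbs the
  -- error in `ln (1 + bε) ≥ bε / (1 + bε) ≥ cε`, valid once `cbε ≤ b - c`.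
  obtain ⟨c, hhc, hcC⟩ := exists_between hC
  obtain ⟨b, hcb, hbC⟩ := exists_between hcC
  have hc0 : 0 < c := h0.trans_lt hhc
  have hb0 : 0 < b := hc0.trans hcb
  have hC0 : 0 < C := hb0.trans hbC
  have hgrow : ∀ r ≥ 1, f 1 + c * (r - 1) ≤ f r := by
    intro r hr
    refine add_mul_le_of_forall_exists_lt (monotoneOn_log_measure_ball hCD x₀) hc0 ?_ hr
    intro r hr δ hδ
    have hv0 := (Metric.measure_ball_pos m x₀ hr).ne'
    have hvT := measure_ball_ne_top_of_isCD hCD x₀ r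
    set v := (m (Metric.ball x₀ r)).toReal with hv
    have hvpos : 0 < v := ENNReal.toReal_pos hv0 hvT
    have hlt : ENNReal.ofReal b * m (Metric.ball x₀ r)
        < minkowskiContent m (Metric.ball x₀ r) := by
      refine lt_of_lt_of_le ?_ (hcon r hr)
      exact (ENNReal.mul_lt_mul_iff_left hv0 hvT).2 ((ENNReal.ofReal_lt_ofReal_iff hC0).2 hbC)
    have hev := eventually_lt_of_lt_liminf hlt
    have hsmall : ∀ᶠ ε : ℝ in 𝓝[>] 0, ε ∈ Set.Ioo 0 (min δ ((b - c) / (c * b))) :=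
      Ioo_mem_nhdsGT (lt_min hδ (div_pos (by linarith) (by positivity)))
    obtain ⟨ε, hε1, hε2⟩ := (hev.and hsmall).exists
    have hε : 0 < ε := hε2.1
    refine ⟨ε, hε, hε2.2.trans_le (min_le_left _ _), ?_⟩
    have hεb : ε * (c * b) < b - c :=
      (lt_div_iff₀ (by positivity)).1 (hε2.2.trans_le (min_le_right _ _))
    have hVT := measure_ball_ne_top_of_isCD hCD x₀ (r + ε)
    set V := (m (Metric.ball x₀ (r + ε))).toReal with hV
    have hle : v * (1 + b * ε) ≤ V := by
      have h1 := (ENNReal.lt_div_iff_mul_lt (Or.inl (by simpa using hε))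
        (Or.inl ENNReal.ofReal_ne_top)).1 hε1
      have h2 : ENNReal.ofReal b * m (Metric.ball x₀ r) * ENNReal.ofReal ε
          + m (Metric.ball x₀ r) ≤ m (Metric.ball x₀ (r + ε)) := by
        refine (lt_tsub_iff_right.1 h1).le.trans (measure_mono ?_)
        exact thickening_subset_ball subset_rfl
      rw [← ENNReal.ofReal_toReal hvT, ← ENNReal.ofReal_toReal hVT, ← hv, ← hV,
        ← ENNReal.ofReal_mul hb0.le, ← ENNReal.ofReal_mul (by positivity),
        ← ENNReal.ofReal_add (by positivity) hvpos.le,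
        ENNReal.ofReal_le_ofReal_iff ENNReal.toReal_nonneg] at h2
      linarith
    have hpos : 0 < 1 + b * ε := by positivity
    have hlog := Real.log_le_log (by positivity) hle
    rw [Real.log_mul hvpos.ne' hpos.ne'] at hlog
    have h3 := Real.one_sub_inv_le_log_of_pos hpos
    have h4 : c * ε ≤ 1 - (1 + b * ε)⁻¹ := by
      have : 1 - (1 + b * ε)⁻¹ = b * ε / (1 + b * ε) := by field_simp; ring
      rw [this, le_div_iff₀ hpos]
      nlinarith
    linarith
  have hlim : Tendsto (fun r : ℝ => f 1 / r + c * (1 - 1 / r)) atTop (𝓝 (0 + c * (1 - 0))) :=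
    (tendsto_id.const_div_atTop _).add
      ((tendsto_const_nhds.sub (tendsto_id.const_div_atTop 1)).const_mul c)
  have : 0 + c * (1 - 0) ≤ h := by
    refine le_of_tendsto_of_tendsto hlim hh ?_
    filter_upwards [eventually_ge_atTop 1] with r hr
    have hr0 : 0 < r := by linarith
    have e : f 1 / r + c * (1 - 1 / r) = (f 1 + c * (r - 1)) / r := by field_simp
    rw [e]
    exact div_le_div_of_nonneg_right (hgrow r hr) hr0.le
  linarith

end VolumeEntropy

/-! ### The main theorem -/

theorem theorem3p3 {X : Type*} [MetricSpace X] [CompleteSpace X] [SecondCountableTopology X]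
    [NoncompactSpace X] [MeasurableSpace X] [BorelSpace X]
    (m : Measure X) [IsLocallyFiniteMeasure m] [m.IsOpenPosMeasure]
    (hCD : IsCDZeroInfty m) :
    ∃ h : ℝ≥0∞, (∀ x₀ : X, HasVolumeEntropyAt m x₀ h) ∧
      (∀ C : ℝ≥0∞, h < C →
        ¬ ∀ Ω : Set X, MeasurableSet Ω → m Ω < ∞ → C * m Ω ≤ minkowskiContent m Ω) ∧
      (m Set.univ = ∞ → cheegerConstant m = h) := by
  have : Nonempty X := nonempty_of_neBot (cocompact X)
  obtain ⟨h, h0, hh⟩ := exists_forall_tendsto_log_measure_ball_div hCD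
  have x₀ : X := Classical.arbitrary X
  have hnot : ∀ C : ℝ≥0∞, ENNReal.ofReal h < C →
      ¬ ∀ Ω : Set X, MeasurableSet Ω → m Ω < ∞ → C * m Ω ≤ minkowskiContent m Ω := by
    intro C hC hall
    obtain ⟨c, -, hc, hcC⟩ := ENNReal.lt_iff_exists_real_btwn.1 hC
    obtain ⟨r, -, hr⟩ := exists_minkowskiContent_ball_lt hCD h0 (hh x₀)
      (ENNReal.ofReal_lt_ofReal_iff'.1 hc).1
    refine absurd (hall (Metric.ball x₀ r) Metric.isOpen_ball.measurableSet
      (measure_ball_ne_top_of_isCD hCD x₀ r).lt_top) (not_le.2 (hr.trans_le ?_))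
    gcongr
  refine ⟨ENNReal.ofReal h, fun x => hasVolumeEntropyAt_of_tendsto hCD h0 (hh x), hnot,
    fun _ => le_antisymm ?_ ?_⟩
  · refine le_of_forall_gt_imp_ge_of_dense fun C hC => ?_
    have hex := hnot C hC
    push Not at hex
    obtain ⟨Ω, hΩ, hT, hlt⟩ := hex
    -- A violating set cannot be null, so it competes in the Cheeger infimum.
    have hpos : 0 < m Ω := by
      rcases eq_or_ne (m Ω) 0 with h' | h'
      · simp [h'] at hlt
      · exact pos_iff_ne_zero.2 h'
    unfold cheegerConstant
    refine (iInf₂_le_of_le Ω hΩ (iInf₂_le hpos hT)).trans ?_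
    exact ENNReal.div_le_of_le_mul hlt.le
  · refine le_iInf₂ fun Ω hΩ => le_iInf₂ fun hpos hT => ?_
    rw [ENNReal.le_div_iff_mul_le (Or.inl hpos.ne') (Or.inl hT.ne)]
    exact ofReal_mul_measure_le_minkowskiContent hCD h0 (hh x₀) hΩ hT.ne
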